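/- Call a topological space \emph{pseudocompact} if it is Tychonoff (that is, Hausdorff and completely regular) and every continuous real-valued function on it is bounded. Call a topological space \emph{functionally countable} if every continuous real-valued function on it has countable image. \textbf{Theorem.} Let $X$ and $Y$ be topological spaces, each of which is pseudocompact and functionally countable. Then the product space $X\times Y$ is pseudocompact and functionally countable. -/

import Mathlib

/-- A topological space is pseudocompact if it is Tychonoff (completely regular and Hausdorff)
and every continuous real-valued function on it is bounded. -/
structure IsPseudocompactSpace (X : Type*) [TopologicalSpace X] : Prop where
  tychonoff : T35Space X
  bounded : ∀ f : X → ℝ, Continuous f → Bornology.IsBounded (Set.range f)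

/-- A topological space is functionally countable if every continuous real-valued function on it
has countable image. -/
def IsFunctionallyCountable (X : Type*) [TopologicalSpace X] : Prop :=
  ∀ f : X → ℝ, Continuous f → (Set.range f).Countable

/-!
Call a family of nonempty sets splitting if every member `F` has two members contained in `F ∩ W`
and `F \ W` respectively, for some clopen set `W`. A pseudocompact functionally countable space `X`
admits only the empty splitting family (`IsPseudocompactSpace.eq_empty_of_splitting`), since a
nonempty one would produce a continuous surjection from `X` onto the Cantor space. This plays the role of
the scatteredness of the Stone–Čech compactification of `X`. As `X` is zero-dimensional, it follows
that

* the isolated points of `X` are dense (`IsPseudocompactSpace.dense_setOf_isOpen_singleton`);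
* every sequence of isolated points has a subsequence converging in `X`
  (`IsPseudocompactSpace.exists_subseq_tendsto`);
* every continuous image of `X` in a metric space is countable
  (`IsPseudocompactSpace.countable_range`).

The first two properties pass to products of two such spaces. If a continuous function on `X × Y`
were unbounded, a sequence of isolated points on which it tends to infinity would contradict them;
hence `X × Y` is pseudocompact. In the same way they show, for a continuous `f : X × Y → ℝ`, that
the map sending `x` to the section `f (x, ·)` is continuous for the supremum metric
(`IsPseudocompactSpace.eventually_forall_dist_le`). By the third property there are only countably
many sections, and each has countable range because `Y` is functionally countable.
-/

open Set Filter Topology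

/-! ### Real-valued functions on pseudocompact and functionally countable spaces -/

theorem IsPseudocompactSpace.isClosed_range {X : Type*} [TopologicalSpace X]
    (hX : IsPseudocompactSpace X) {f : X → ℝ} (hf : Continuous f) : IsClosed (range f) := by
  refine isClosed_of_closure_subset fun p hp => ?_
  by_contra hpr
  have hne : ∀ x, f x - p ≠ 0 := fun x h => hpr ⟨x, by linarith⟩
  obtain ⟨C, hC⟩ := (hX.bounded _ ((hf.sub continuous_const).inv₀ hne)).exists_norm_le
  have hC' : ∀ x, |f x - p|⁻¹ ≤ C := fun x => by simpa using hC _ (mem_range_self x)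
  obtain ⟨_, ⟨x, rfl⟩, hx⟩ := Metric.mem_closure_iff.1 hp (|C| + 1)⁻¹ (by positivity)
  rw [dist_comm, Real.dist_eq] at hx
  have h := (lt_inv_comm₀ (abs_pos.2 (hne x)) (by positivity)).1 hx
  linarith [hC' x, le_abs_self C]

/-- Any threshold omitted by `f` works, and `f` omits some threshold since its range is countable. -/
theorem IsFunctionallyCountable.exists_isClopen_lt {X : Type*} [TopologicalSpace X]
    (hX : IsFunctionallyCountable X) {f : X → ℝ} (hf : Continuous f) {a b : ℝ} (hab : a < b) :
    ∃ r ∈ Ioo a b, IsClopen {x | f x < r} := by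
  obtain ⟨r, hr, har, hrb⟩ := ((hX f hf).dense_compl ℝ).exists_between hab
  refine ⟨r, ⟨har, hrb⟩, ?_, isOpen_lt hf continuous_const⟩
  have : {x | f x < r} = {x | f x ≤ r} := by
    ext x
    exact ⟨fun h => le_of_lt (mem_ofPred.1 h), fun h => lt_of_le_of_ne h fun h' => hr ⟨x, h'⟩⟩
  rw [this]
  exact isClosed_le hf continuous_const

theorem IsFunctionallyCountable.exists_isClopen_subset {X : Type*} [TopologicalSpace X]
    [T35Space X] (hX : IsFunctionallyCountable X) {x : X} {U : Set X} (hU : U ∈ 𝓝 x) :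
    ∃ W, IsClopen W ∧ x ∈ W ∧ W ⊆ U := by
  obtain ⟨V, hVU, hV, hxV⟩ := mem_nhds_iff.1 hU
  obtain ⟨f, hf, hfx, hfV⟩ := CompletelyRegularSpace.completely_regular_isOpen x V hV hxV
  obtain ⟨r, hr, hW⟩ := hX.exists_isClopen_lt (continuous_subtype_val.comp hf) one_pos
  refine ⟨_, hW, by simpa [hfx] using hr.1, fun y hy => hVU ?_⟩
  by_contra hyV
  have h1 : (f y : ℝ) < r := hy
  rw [hfV hyV] at h1
  exact absurd h1 (not_lt.2 hr.2.le)

/-! ### Splitting families -/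

/-- A substitute for scatteredness: if `𝓕` is nonempty, following the splittings along all
branches of the binary tree yields a continuous map to the Cantor space `ℕ → Bool` with dense image. By
pseudocompactness the image is closed, hence everything, and so uncountable. -/
theorem IsPseudocompactSpace.eq_empty_of_splitting {X : Type*} [TopologicalSpace X]
    (hX : IsPseudocompactSpace X) (hX' : IsFunctionallyCountable X) {𝓕 : Set (Set X)}
    (hne : ∀ F ∈ 𝓕, F.Nonempty)
    (hsplit : ∀ F ∈ 𝓕, ∃ W A B, IsClopen W ∧ A ∈ 𝓕 ∧ A ⊆ F ∩ W ∧ B ∈ 𝓕 ∧ B ⊆ F \ W) :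
    𝓕 = ∅ := by
  classical
  by_contra h𝓕
  obtain ⟨F₀, hF₀⟩ := nonempty_iff_ne_empty.2 h𝓕
  choose! W L R hW hL hLW hR hRW using hsplit
  let next : Bool → 𝓕 → 𝓕 := fun c F => bif c then ⟨L F, hL F F.2⟩ else ⟨R F, hR F F.2⟩
  -- the node of the tree reached by `x` at level `n`
  let s : ℕ → X → 𝓕 := fun n x =>
    Nat.rec ⟨F₀, hF₀⟩ (fun _ F => next (decide (x ∈ W F.1)) F) n
  have s_succ : ∀ n x, s (n + 1) x = next (decide (x ∈ W (s n x).1)) (s n x) :=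
    fun _ _ => rfl
  let e : X → ℕ → Bool := fun x n => decide (x ∈ W (s n x).1)
  have hloc : ∀ (F : 𝓕) (x : X), ∀ᶠ y in 𝓝 x, (y ∈ W F ↔ x ∈ W F) := fun F x => by
    by_cases hx : x ∈ W F
    · filter_upwards [(hW F F.2).isOpen.mem_nhds hx] with y hy using by simp [hx, hy]
    · filter_upwards [(hW F F.2).compl.isOpen.mem_nhds hx] with y hy
      exact ⟨fun h => absurd h hy, fun h => absurd h hx⟩
  have hs : ∀ n x, ∀ᶠ y in 𝓝 x, s n y = s n x := by
    intro n
    induction n with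
    | zero => exact fun x => Eventually.of_forall fun _ => rfl
    | succ n ih =>
      intro x
      filter_upwards [ih x, hloc (s n x) x] with y h1 h2
      simp only [s_succ, h1, h2]
  have he : Continuous e := by
    refine continuous_pi fun n => continuous_iff_continuousAt.2 fun x => ?_
    refine ContinuousAt.congr (continuousAt_const (y := e x n)) ?_
    filter_upwards [hs n x, hloc (s n x) x] with y h1 h2
    simp only [e, h1, h2]
  have hdense : ∀ b : ℕ → Bool, b ∈ closure (range e) := by
    intro b
    let t : ℕ → 𝓕 := fun n => Nat.rec ⟨F₀, hF₀⟩ (fun n F => next (b n) F) n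
    have t_succ : ∀ n, t (n + 1) = next (b n) (t n) := fun _ => rfl
    have ht : ∀ n, ∀ x ∈ (t n).1, s n x = t n ∧ ∀ k < n, e x k = b k := by
      intro n
      induction n with
      | zero => exact fun x _ => ⟨rfl, by simp⟩
      | succ n ih =>
        intro x hx
        have hx' : x ∈ (t n).1 ∧ decide (x ∈ W (t n).1) = b n := by
          rw [t_succ] at hx
          cases hb : b n with
          | true =>
            rw [hb] at hx
            have := hLW _ (t n).2 hx
            exact ⟨this.1, decide_eq_true this.2⟩
          | false =>
            rw [hb] at hx
            have := hRW _ (t n).2 hx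
            exact ⟨this.1, decide_eq_false this.2⟩
        obtain ⟨h1, h2⟩ := ih x hx'.1
        refine ⟨by rw [s_succ, t_succ, h1, hx'.2], fun k hk => ?_⟩
        rcases Nat.lt_succ_iff_lt_or_eq.1 hk with hk | rfl
        · exact h2 k hk
        · simp only [e, h1, hx'.2]
    choose x hx using fun n => hne _ (t n).2
    refine mem_closure_of_tendsto (f := fun n => e (x n)) (b := atTop) ?_
      (Eventually.of_forall fun n => mem_range_self _)
    refine tendsto_pi_nhds.2 fun k => tendsto_const_nhds.congr' ?_
    filter_upwards [eventually_gt_atTop k] with n hn using ((ht n _ (hx n)).2 k hn).symm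
  let ι : (ℕ → Bool) → ℝ := fun b => (cantorSetHomeomorphNatToBool.symm b : ℝ)
  have hι : Continuous ι := continuous_subtype_val.comp (Homeomorph.continuous _)
  have hιi : Function.Injective ι := Subtype.val_injective.comp (Equiv.injective _)
  have hcl : IsClosed (range e) := by
    have := (hX.isClosed_range (hι.comp he)).preimage hι
    rwa [range_comp, hιi.preimage_image] at this
  have huniv : range e = univ := eq_univ_of_forall fun b => hcl.closure_eq ▸ hdense b
  have hcount := hX' _ (hι.comp he)
  rw [range_comp, huniv] at hcount
  obtain ⟨u, hu⟩ := (countable_of_injective_of_countable_image hιi.injOn hcount).exists_eq_range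
    univ_nonempty
  obtain ⟨n, hn⟩ := hu.subset (mem_univ fun n => !u n n)
  simpa using congrFun hn n

/-! ### Isolated points -/

theorem IsPseudocompactSpace.dense_setOf_isOpen_singleton {X : Type*} [TopologicalSpace X]
    (hX : IsPseudocompactSpace X) (hX' : IsFunctionallyCountable X) :
    Dense {x : X | IsOpen {x}} := by
  have := hX.tychonoff
  refine dense_iff_inter_open.2 fun U hU hUne => ?_
  by_contra hiso
  have hiso' : ∀ x ∈ U, ¬ IsOpen {x} := fun x hx h => hiso ⟨x, hx, h⟩
  -- without isolated points in `U`, the nonempty open subsets of `U` form a splitting family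
  refine (hX.eq_empty_of_splitting hX' (𝓕 := {F | IsOpen F ∧ F.Nonempty ∧ F ⊆ U})
    (fun F hF => hF.2.1) ?_).subset ⟨hU, hUne, Subset.rfl⟩
  rintro F ⟨hF, ⟨x, hx⟩, hFU⟩
  obtain ⟨y, hy, hyx⟩ : ∃ y ∈ F, y ≠ x := by
    by_contra! h
    exact hiso' x (hFU hx) (eq_singleton_iff_unique_mem.2 ⟨hx, h⟩ ▸ hF)
  obtain ⟨W, hW, hxW, hWy⟩ := hX'.exists_isClopen_subset (isOpen_ne.mem_nhds hyx.symm)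
  exact ⟨W, F ∩ W, F \ W, hW,
    ⟨hF.inter hW.isOpen, ⟨x, hx, hxW⟩, inter_subset_left.trans hFU⟩, Subset.rfl,
    ⟨hF.sdiff hW.isClosed, ⟨y, hy, fun h => hWy h rfl⟩, sdiff_subset.trans hFU⟩, Subset.rfl⟩

/-- Otherwise the function sending `x n` to `n` for `n ∈ A`, and all other points to `0`, is
continuous and unbounded. -/
theorem IsPseudocompactSpace.exists_forall_nhds_infinite {X : Type*} [TopologicalSpace X]
    (hX : IsPseudocompactSpace X) {x : ℕ → X} (hx : ∀ n, IsOpen {x n}) {A : Set ℕ}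
    (hA : A.Infinite) : ∃ p, ∀ N ∈ 𝓝 p, (A ∩ x ⁻¹' N).Infinite := by
  have := hX.tychonoff
  by_contra! h
  have hfin : ∀ z, (A ∩ x ⁻¹' {z}).Finite := fun z => by
    obtain ⟨N, hN, hf⟩ := h z
    exact hf.subset fun n hn => ⟨hn.1, by
      rw [mem_preimage, mem_singleton_iff.1 hn.2]; exact mem_of_mem_nhds hN⟩
  -- the supremum accounts for repetitions in the sequence, and is `0` on the empty set
  let F : X → ℝ := fun z => (sSup (A ∩ x ⁻¹' {z}) : ℕ)
  have hF : Continuous F := by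
    refine continuous_iff_continuousAt.2 fun z => ?_
    by_cases hz : IsOpen {z}
    · exact ContinuousAt.congr (continuousAt_const (y := F z))
        (mem_of_superset (hz.mem_nhds rfl) fun y hy => by
          obtain rfl := mem_singleton_iff.1 hy
          exact rfl)
    have hF0 : ∀ y, (∀ n ∈ A, x n ≠ y) → F y = 0 := fun y hy => by
      have : A ∩ x ⁻¹' {y} = ∅ := eq_empty_of_forall_notMem fun n hn => hy n hn.1 hn.2
      simp [F, this]
    have hzx : ∀ n, x n ≠ z := fun n hn => hz (hn ▸ hx n)
    obtain ⟨N, hN, hf⟩ := h z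
    have hcl : (x '' (A ∩ x ⁻¹' N))ᶜ ∈ 𝓝 z :=
      (hf.image x).isClosed.isOpen_compl.mem_nhds
        fun ⟨n, _, hn⟩ => hzx n hn
    refine ContinuousAt.congr (continuousAt_const (y := 0)) ?_
    filter_upwards [hN, hcl] with y hyN hy
    exact (hF0 y fun n hn hny => hy ⟨n, ⟨hn, by rwa [mem_preimage, hny]⟩, hny⟩).symm
  obtain ⟨C, hC⟩ := (hX.bounded F hF).exists_norm_le
  obtain ⟨m, hm⟩ := exists_nat_gt C
  obtain ⟨n, hn, hmn⟩ := hA.exists_gt m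
  have h1 : (n : ℝ) ≤ F (x n) := Nat.cast_le.2 (le_csSup (hfin _).bddAbove ⟨hn, rfl⟩)
  have h2 := (le_abs_self _).trans (hC _ (mem_range_self (x n)))
  have h3 : (m : ℝ) < n := Nat.cast_lt.2 hmn
  linarith

/-- If no subsequence converges, then the sets `x '' A` with `A` infinite form a splitting family:
a cluster point `p` of `x` along `A` is not its limit along `A`, so some neighbourhood of `p`
contains infinitely many terms and misses infinitely many. -/
theorem IsPseudocompactSpace.exists_subseq_tendsto {X : Type*} [TopologicalSpace X]
    (hX : IsPseudocompactSpace X) (hX' : IsFunctionallyCountable X) {x : ℕ → X}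
    (hx : ∀ n, IsOpen {x n}) : ∃ p, ∃ φ : ℕ → ℕ, StrictMono φ ∧ Tendsto (x ∘ φ) atTop (𝓝 p) := by
  have := hX.tychonoff
  by_contra! hno
  refine (hX.eq_empty_of_splitting hX' (𝓕 := {F | ∃ A : Set ℕ, A.Infinite ∧ x '' A = F})
    ?_ ?_).subset ⟨univ, infinite_univ, rfl⟩
  · rintro _ ⟨A, hA, rfl⟩
    exact hA.nonempty.image x
  rintro _ ⟨A, hA, rfl⟩
  obtain ⟨p, hp⟩ := hX.exists_forall_nhds_infinite hx hA
  obtain ⟨N, hN, hinf⟩ : ∃ N ∈ 𝓝 p, (A \ x ⁻¹' N).Infinite := by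
    by_contra! h
    have hmono := Nat.nth_strictMono (p := (· ∈ A)) hA
    refine hno p _ hmono fun N hN => ?_
    have hfin := (h N hN).preimage
      (f := Nat.nth (· ∈ A)) hmono.injective.injOn
    rw [mem_map, ← Nat.cofinite_eq_atTop, mem_cofinite]
    exact hfin.subset fun k hk => ⟨Nat.nth_mem_of_infinite hA k, hk⟩
  obtain ⟨W, hW, hpW, hWN⟩ := hX'.exists_isClopen_subset hN
  refine ⟨W, _, _, hW, ⟨A ∩ x ⁻¹' W, hp W (hW.isOpen.mem_nhds hpW), rfl⟩, ?_,
    ⟨A \ x ⁻¹' W, hinf.mono (sdiff_subset_sdiff_right (preimage_mono hWN)), rfl⟩, ?_⟩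
  · rintro _ ⟨n, hn, rfl⟩
    exact ⟨⟨n, hn.1, rfl⟩, hn.2⟩
  · rintro _ ⟨n, hn, rfl⟩
    exact ⟨⟨n, hn.1, rfl⟩, hn.2⟩

/-! ### Continuous images in metric spaces -/

theorem exists_forall_nhds_not_countable {M : Type*} [TopologicalSpace M]
    [SecondCountableTopology M] {S : Set M} (hS : ¬ S.Countable) :
    ∃ p ∈ S, ∀ N ∈ 𝓝 p, ¬ (S ∩ N).Countable := by
  have hne : (cocountable ⊓ 𝓟 S).NeBot := by
    refine inf_principal_neBot_iff.2 fun U hU => ?_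
    by_contra h
    rw [not_nonempty_iff_eq_empty] at h
    exact hS ((mem_cocountable.1 hU).mono fun y hy hyU => h.subset ⟨hyU, hy⟩)
  have : CountableInterFilter (cocountable : Filter M) :=
    CardinalInterFilter.toCountableInterFilter _ Cardinal.aleph0_lt_aleph_one
  obtain ⟨p, hpS, hp⟩ := HereditarilyLindelofSpace.isLindelof S
    (inf_le_right : cocountable ⊓ 𝓟 S ≤ 𝓟 S)
  refine ⟨p, hpS, fun N hN hcount => ?_⟩
  have h1 : (S ∩ N)ᶜ ∩ S ∈ cocountable ⊓ 𝓟 S :=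
    inter_mem_inf (by simpa [mem_cocountable] using hcount) (mem_principal_self S)
  obtain ⟨y, hyN, hy, hyS⟩ := clusterPt_iff_nonempty.1 hp hN h1
  exact hy ⟨hyS, hyN⟩

/-- If the range is uncountable, then the sets with uncountable image form a splitting family,
because an uncountable subset of `M` has two distinct condensation points. -/
theorem IsPseudocompactSpace.countable_range_of_separable {X M : Type*} [TopologicalSpace X]
    (hX : IsPseudocompactSpace X) (hX' : IsFunctionallyCountable X) [MetricSpace M]
    [SecondCountableTopology M] {g : X → M} (hg : Continuous g) : (range g).Countable := by
  by_contra hunc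
  refine (hX.eq_empty_of_splitting hX' (𝓕 := {F | ¬ (g '' F).Countable}) ?_ ?_).subset
    (show univ ∈ _ by simpa using hunc)
  · intro F hF
    by_contra h
    rw [not_nonempty_iff_eq_empty] at h
    exact hF (by simp [h])
  intro F hF
  obtain ⟨p, hp, hpN⟩ := exists_forall_nhds_not_countable hF
  have hF' : ¬ (g '' F \ {p}).Countable := fun h =>
    hF ((h.union (countable_singleton p)).mono (by simp))
  obtain ⟨q, ⟨-, hqp⟩, hqN⟩ := exists_forall_nhds_not_countable hF'
  obtain ⟨r, hr, hW⟩ := hX'.exists_isClopen_lt (hg.dist (continuous_const (y := p)))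
    (dist_pos.2 hqp)
  refine ⟨_, F ∩ {x | dist (g x) p < r}, F \ {x | dist (g x) p < r}, hW,
    fun h => hpN _ (Metric.ball_mem_nhds p hr.1) (h.mono ?_), Subset.rfl,
    fun h => hqN _ (Metric.isClosed_closedBall.isOpen_compl.mem_nhds (x := q)
      (s := (Metric.closedBall p r)ᶜ) (by simpa using hr.2)) (h.mono ?_),
    Subset.rfl⟩
  · rintro _ ⟨⟨x, hx, rfl⟩, hxr⟩
    exact ⟨x, ⟨hx, hxr⟩, rfl⟩
  · rintro _ ⟨⟨⟨x, hx, rfl⟩, -⟩, hxr⟩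
    exact ⟨x, ⟨hx, fun h => hxr (le_of_lt (mem_ofPred.1 h))⟩, rfl⟩

/-- The range is separable because the image of the dense set of isolated points is totally
bounded, all sequences of isolated points having convergent subsequences. -/
theorem IsPseudocompactSpace.countable_range {X M : Type*} [TopologicalSpace X]
    (hX : IsPseudocompactSpace X) (hX' : IsFunctionallyCountable X) [MetricSpace M]
    {g : X → M} (hg : Continuous g) : (range g).Countable := by
  have htb : TotallyBounded (g '' {x | IsOpen {x}}) := by
    refine Metric.totallyBounded_iff.2 fun ε hε => ?_
    by_contra! h
    obtain ⟨u, hu⟩ := seq_of_forall_finite_exists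
      (P := fun (x : X) (t : Set X) => IsOpen {x} ∧ ∀ y ∈ t, ε ≤ dist (g x) (g y)) fun t ht => by
        obtain ⟨_, ⟨x, hx, rfl⟩, hxt⟩ := not_subset.1 (h _ (ht.image g))
        refine ⟨x, hx, fun y hy => ?_⟩
        by_contra! hlt
        exact hxt (mem_iUnion₂.2 ⟨g y, mem_image_of_mem g hy, hlt⟩)
    obtain ⟨p, φ, hφ, hlim⟩ := hX.exists_subseq_tendsto hX' fun n => (hu n).1
    have hc := ((hg.tendsto p).comp hlim).cauchySeq
    obtain ⟨N, hN⟩ := Metric.cauchySeq_iff'.1 hc ε hε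
    exact absurd (hN (N + 1) N.le_succ)
      (not_lt.2 ((hu _).2 _ (mem_image_of_mem u (hφ N.lt_succ_self))))
  have hsep : TopologicalSpace.IsSeparable (range g) := htb.isSeparable.closure.mono
    (hg.range_subset_closure_image_dense (hX.dense_setOf_isOpen_singleton hX'))
  have := hsep.separableSpace
  have := UniformSpace.secondCountable_of_separable (range g)
  have h := hX.countable_range_of_separable hX' hg.rangeFactorization
  have h' := h.image Subtype.val
  rwa [← range_comp] at h'

/-! ### Products -/

theorem IsPseudocompactSpace.exists_subseq_tendsto_prod {X Y : Type*} [TopologicalSpace X]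
    [TopologicalSpace Y] (hX : IsPseudocompactSpace X) (hX' : IsFunctionallyCountable X)
    (hY : IsPseudocompactSpace Y) (hY' : IsFunctionallyCountable Y) {x : ℕ → X} {y : ℕ → Y}
    (hx : ∀ n, IsOpen {x n}) (hy : ∀ n, IsOpen {y n}) :
    ∃ p q, ∃ φ : ℕ → ℕ, StrictMono φ ∧ Tendsto (x ∘ φ) atTop (𝓝 p) ∧
      Tendsto (y ∘ φ) atTop (𝓝 q) := by
  obtain ⟨p, φ, hφ, hp⟩ := hX.exists_subseq_tendsto hX' hx
  obtain ⟨q, ψ, hψ, hq⟩ := hY.exists_subseq_tendsto hY' (x := y ∘ φ) fun n => hy _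
  exact ⟨p, q, φ ∘ ψ, hφ.comp hψ, hp.comp hψ.tendsto_atTop, hq⟩

theorem IsPseudocompactSpace.exists_isolated_mem {X Y : Type*} [TopologicalSpace X]
    [TopologicalSpace Y] (hX : IsPseudocompactSpace X) (hX' : IsFunctionallyCountable X)
    (hY : IsPseudocompactSpace Y) (hY' : IsFunctionallyCountable Y) {O : Set (X × Y)}
    (hO : IsOpen O) (hne : O.Nonempty) : ∃ x y, IsOpen {x} ∧ IsOpen {y} ∧ (x, y) ∈ O := by
  obtain ⟨z, hz, h1, h2⟩ := ((hX.dense_setOf_isOpen_singleton hX').prod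
    (hY.dense_setOf_isOpen_singleton hY')).inter_open_nonempty O hO hne
  exact ⟨z.1, z.2, h1, h2, hz⟩

theorem IsPseudocompactSpace.prod {X Y : Type*} [TopologicalSpace X] [TopologicalSpace Y]
    (hX : IsPseudocompactSpace X) (hX' : IsFunctionallyCountable X)
    (hY : IsPseudocompactSpace Y) (hY' : IsFunctionallyCountable Y) :
    IsPseudocompactSpace (X × Y) := by
  have := hX.tychonoff
  have := hY.tychonoff
  refine ⟨?_, fun f hf => ?_⟩
  · exact {}
  by_contra hunb
  have hlarge : ∀ n : ℕ, ∃ x y, IsOpen {x} ∧ IsOpen {y} ∧ (n : ℝ) < |f (x, y)| := fun n => by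
    refine hX.exists_isolated_mem hX' hY hY' (O := {z | (n : ℝ) < |f z|})
      (isOpen_lt continuous_const hf.abs) ?_
    by_contra h
    refine hunb (isBounded_iff_forall_norm_le.2 ⟨n, ?_⟩)
    rintro _ ⟨z, rfl⟩
    by_contra hz
    exact h ⟨z, not_le.1 hz⟩
  choose x y hx hy hxy using hlarge
  obtain ⟨p, q, φ, hφ, hp, hq⟩ := hX.exists_subseq_tendsto_prod hX' hY hY' hx hy
  have hlim : Tendsto (fun n => |f (x (φ n), y (φ n))|) atTop (𝓝 |f (p, q)|) :=
    (hf.abs.tendsto (p, q)).comp (hp.prodMk_nhds hq)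
  refine not_tendsto_atTop_of_tendsto_nhds hlim (tendsto_atTop_mono (fun n => ?_)
    tendsto_natCast_atTop_atTop)
  exact (Nat.cast_le.2 (hφ.id_le n)).trans (hxy (φ n)).le

/-- The sections `f (·, y)` of a continuous function on the product are equicontinuous. -/
theorem IsPseudocompactSpace.eventually_forall_dist_le {X Y : Type*} [TopologicalSpace X]
    [TopologicalSpace Y] (hX : IsPseudocompactSpace X) (hX' : IsFunctionallyCountable X)
    (hY : IsPseudocompactSpace Y) (hY' : IsFunctionallyCountable Y) {f : X × Y → ℝ}
    (hf : Continuous f) (x₀ : X) {ε : ℝ} (hε : 0 < ε) :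
    ∀ᶠ x in 𝓝 x₀, ∀ y, dist (f (x, y)) (f (x₀, y)) ≤ ε := by
  by_contra hnot
  have hf₀ : Continuous fun z : X × Y => f (x₀, z.2) := by fun_prop
  -- Choose isolated points `z n = (xₙ, yₙ)` with `f (xₙ, yₙ)` far from `f (x₀, yₙ)`, but with
  -- `f (xₘ, yₙ)` close to `f (x₀, yₙ)` for all `m > n`.
  obtain ⟨z, hz⟩ := seq_of_forall_finite_exists
    (P := fun (z : X × Y) (t : Set (X × Y)) => (IsOpen {z.1} ∧ IsOpen {z.2} ∧
      ε < dist (f z) (f (x₀, z.2))) ∧ ∀ w ∈ t, dist (f (z.1, w.2)) (f (x₀, w.2)) < ε / 2)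
    fun t ht => by
      have hU : ∀ᶠ x in 𝓝 x₀, ∀ w ∈ t, dist (f (x, w.2)) (f (x₀, w.2)) < ε / 2 := by
        refine (eventually_all_finite ht).2 fun w _ => ?_
        have : Continuous fun x => f (x, w.2) := by fun_prop
        exact this.tendsto x₀ (Metric.ball_mem_nhds _ (half_pos hε))
      obtain ⟨U, hUt, hUo, hxU⟩ := eventually_nhds_iff.1 hU
      obtain ⟨x, y, hx, hy, hxU', hxy⟩ := hX.exists_isolated_mem hX' hY hY'
        (O := Prod.fst ⁻¹' U ∩ {z | ε < dist (f z) (f (x₀, z.2))})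
        ((hUo.preimage continuous_fst).inter (isOpen_lt continuous_const (hf.dist hf₀))) (by
          by_contra hemp
          refine hnot (mem_of_superset (hUo.mem_nhds hxU) fun x hx y => ?_)
          by_contra hlt
          exact hemp ⟨(x, y), hx, not_le.1 hlt⟩)
      exact ⟨(x, y), ⟨hx, hy, hxy⟩, hUt x hxU'⟩
  obtain ⟨p, q, φ, hφ, hp, hq⟩ := hX.exists_subseq_tendsto_prod hX' hY hY'
    (fun n => (hz n).1.1) (fun n => (hz n).1.2.1)
  -- compare consecutive terms of the convergent subsequence in the first coordinate
  have h1 : Tendsto (fun n => f (z (φ n))) atTop (𝓝 (f (p, q))) :=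
    (hf.tendsto (p, q)).comp (hp.prodMk_nhds hq)
  have h2 : Tendsto (fun n => f ((z (φ (n + 1))).1, (z (φ n)).2)) atTop (𝓝 (f (p, q))) :=
    (hf.tendsto (p, q)).comp ((hp.comp (tendsto_add_atTop_nat 1)).prodMk_nhds hq)
  have h3 := h1.dist h2
  rw [dist_self] at h3
  obtain ⟨n, hn⟩ := (h3.eventually_lt_const (half_pos hε)).exists
  have h4 := (hz (φ n)).1.2.2
  have h5 := (hz (φ (n + 1))).2 _ (mem_image_of_mem z (hφ n.lt_succ_self))
  linarith [dist_triangle (f (z (φ n))) (f ((z (φ (n + 1))).1, (z (φ n)).2))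
    (f (x₀, (z (φ n)).2))]

theorem IsFunctionallyCountable.prod {X Y : Type*} [TopologicalSpace X] [TopologicalSpace Y]
    (hX : IsPseudocompactSpace X) (hX' : IsFunctionallyCountable X)
    (hY : IsPseudocompactSpace Y) (hY' : IsFunctionallyCountable Y) :
    IsFunctionallyCountable (X × Y) := by
  intro f hf
  have hcont : ∀ x, Continuous fun y => f (x, y) := fun x => by fun_prop
  have hbdd : ∀ x, ∃ C, ∀ y, ‖f (x, y)‖ ≤ C := fun x => by
    obtain ⟨C, hC⟩ := (hY.bounded _ (hcont x)).exists_norm_le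
    exact ⟨C, fun y => hC _ (mem_range_self y)⟩
  choose C hC using hbdd
  -- the map sending a point to its section, with the supremum metric on sections
  let g : X → BoundedContinuousFunction Y ℝ := fun x =>
    BoundedContinuousFunction.ofNormedAddCommGroup _ (hcont x) (C x) (hC x)
  have hg : Continuous g := by
    refine continuous_iff_continuousAt.2 fun x₀ => Metric.tendsto_nhds.2 fun ε hε => ?_
    filter_upwards [hX.eventually_forall_dist_le hX' hY hY' hf x₀ (half_pos hε)] with x hx
    exact ((BoundedContinuousFunction.dist_le (half_pos hε).le).2 hx).trans_lt (half_lt_self hε)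
  have hcount : (⋃ h ∈ range g, range h).Countable := by
    refine (hX.countable_range hX' hg).biUnion ?_
    rintro _ ⟨x, rfl⟩
    exact hY' _ (hcont x)
  refine hcount.mono ?_
  rintro _ ⟨⟨x, y⟩, rfl⟩
  exact mem_biUnion (mem_range_self x) (mem_range_self (f := g x) y)

theorem mainTheorem1 {X Y : Type*} [TopologicalSpace X] [TopologicalSpace Y]
    (hX : IsPseudocompactSpace X) (hX' : IsFunctionallyCountable X)
    (hY : IsPseudocompactSpace Y) (hY' : IsFunctionallyCountable Y) :
    IsPseudocompactSpace (X × Y) ∧ IsFunctionallyCountable (X × Y) :=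
  ⟨hX.prod hX' hY hY', IsFunctionallyCountable.prod hX hX' hY hY'⟩
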